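/- Let $(M_1,g_1)$ and $(M_2,g_2)$ be nonempty smooth pseudo-Riemannian manifolds (without boundary) of dimensions $n_1$ and $n_2$, with $n_2\ge 1$ and $n:=n_1+n_2\ge 3$; let $f\colon M_1\to(0,\infty)$ be smooth, and let $M=M_1\times_f M_2$ be the warped product, i.e. $M_1\times M_2$ with the metric $g=\pi_1^*g_1+(f\circ\pi_1)^2\,\pi_2^*g_2$, where $\pi_i$ is the projection onto $M_i$. For a pseudo-Riemannian metric $g$ in dimension $n$ with Levi-Civita connection $\nabla$ put $\mathcal R(X,Y)Z=\nabla_Y\nabla_XZ-\nabla_X\nabla_YZ+\nabla_{[X,Y]}Z$, let $\tau$ be the scalar curvature (the trace with respect to $g$ of the Ricci tensor $\mathrm{Ric}(X,Y)=\operatorname{trace}(V\mapsto\mathcal R(X,V)Y)$), and let $$\mathcal C(X,Y)Z=\mathcal R(X,Y)Z-\frac{\tau}{n(n-1)}\bigl[g(X,Z)Y-g(Y,Z)X\bigr]$$ be the concircular curvature tensor. A pseudo-Riemannian manifold is locally symmetric if $\nabla\mathcal R=0$, concircularly symmetric if $\nabla\mathcal C=0$, and of constant curvature if there is a constant $\kappa\in\mathbb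 R$ with $\mathcal R(X,Y)Z=\kappa\,[g(X,Z)Y-g(Y,Z)X]$ everywhere. **Theorem.** Suppose that $M=M_1\times_fM_2$ is concircularly symmetric. Then 1. both $(M_1,g_1)$ and $(M_2,g_2)$ are locally symmetric; 2. if $M_1$ is connected and $f$ is not constant, then $(M_2,g_2)$ is of constant curvature; 3. the tensor $\mathcal F=\frac1f H^f$ on $M_1$ is parallel, $\nabla^1\mathcal F=0$, where $\nabla^1$ is the Levi-Civita connection of $g_1$ and $H^f(X,Y)=g_1(\nabla^1_X\operatorname{grad}f,Y)$ is the Hessian of $f$. -/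

import Mathlib

open scoped Manifold ContDiff

namespace PseudoRiem

/-! ### Tensor calculus in a coordinate domain

`h` is a field of bilinear forms on (an open subset of) a finite-dimensional real vector space `E`,
that is, a metric read in a chart.  Vector fields are maps `E → E`; tensors are evaluated on
constant (coordinate) vector fields. -/

section Local

variable {E : Type*} [NormedAddCommGroup E] [NormedSpace ℝ E]

/-- The vector dual to the covector `α` at `x`: the unique `v` with `h x v w = α w` for all `w`,
when `h x` is nondegenerate. -/
noncomputable def sharp (h : E → E →L[ℝ] E →L[ℝ] ℝ) (x : E) (α : E →L[ℝ] ℝ) : E :=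
  (h x).inverse α

/-- The Christoffel map: `h (Γ(u, v), w) = (1/2) (∂_u h(v, w) + ∂_v h(u, w) - ∂_w h(u, v))`. -/
noncomputable def christoffel (h : E → E →L[ℝ] E →L[ℝ] ℝ) (x u v : E) : E :=
  sharp h x ((1 / 2 : ℝ) •
    (fderiv ℝ h x u v + fderiv ℝ h x v u - ((fderiv ℝ h x).flip u).flip v))

/-- The Levi-Civita covariant derivative `∇_V W` of vector fields. -/
noncomputable def covDeriv (h : E → E →L[ℝ] E →L[ℝ] ℝ) (V W : E → E) (x : E) : E :=
  fderiv ℝ W x (V x) + christoffel h x (V x) (W x)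

/-- The curvature operator on vector fields,
`R(X, Y)Z = ∇_Y ∇_X Z - ∇_X ∇_Y Z + ∇_[X, Y] Z`. -/
noncomputable def curvatureField (h : E → E →L[ℝ] E →L[ℝ] ℝ) (X Y Z : E → E) (x : E) : E :=
  covDeriv h Y (covDeriv h X Z) x - covDeriv h X (covDeriv h Y Z) x
    + covDeriv h (VectorField.lieBracket ℝ X Y) Z x

/-- The curvature tensor `R(u, v)w` at `x`. -/
noncomputable def curvature (h : E → E →L[ℝ] E →L[ℝ] ℝ) (x u v w : E) : E :=
  curvatureField h (fun _ => u) (fun _ => v) (fun _ => w) x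

/-- The tensor `G(u, v)w = h(u, w) v - h(v, w) u`. -/
noncomputable def tensorG (h : E → E →L[ℝ] E →L[ℝ] ℝ) (x u v w : E) : E :=
  h x u w • v - h x v w • u

/-- The Ricci tensor `Ric(u, v)`, the trace of `w ↦ R(u, w)v`. -/
noncomputable def ricci [FiniteDimensional ℝ E] (h : E → E →L[ℝ] E →L[ℝ] ℝ) (x u v : E) : ℝ :=
  ∑ i, (Module.finBasis ℝ E).coord i (curvature h x u (Module.finBasis ℝ E i) v)

/-- The entries `h^{ij}` of the inverse metric. -/
noncomputable def invMetric [FiniteDimensional ℝ E] (h : E → E →L[ℝ] E →L[ℝ] ℝ) (x : E)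
    (i j : Fin (Module.finrank ℝ E)) : ℝ :=
  (Module.finBasis ℝ E).coord i
    (sharp h x (LinearMap.toContinuousLinearMap ((Module.finBasis ℝ E).coord j)))

/-- The scalar curvature `τ = h^{ij} Ric_{ij}`. -/
noncomputable def scalarCurvature [FiniteDimensional ℝ E] (h : E → E →L[ℝ] E →L[ℝ] ℝ)
    (x : E) : ℝ :=
  ∑ i, ∑ j, invMetric h x i j * ricci h x (Module.finBasis ℝ E i) (Module.finBasis ℝ E j)

/-- The concircular curvature tensor
`C(u, v)w = R(u, v)w - τ / (n (n - 1)) (h(u, w) v - h(v, w) u)`, where `n = dim E`. -/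
noncomputable def concircular [FiniteDimensional ℝ E] (h : E → E →L[ℝ] E →L[ℝ] ℝ)
    (x u v w : E) : E :=
  curvature h x u v w -
    (scalarCurvature h x / ((Module.finrank ℝ E : ℝ) * ((Module.finrank ℝ E : ℝ) - 1))) •
      tensorG h x u v w

/-- The covariant derivative `(∇_z T)(u, v, w)` of a tensor field of type `(1, 3)`. -/
noncomputable def nablaThree (h : E → E →L[ℝ] E →L[ℝ] ℝ) (T : E → E → E → E → E)
    (x z u v w : E) : E :=
  covDeriv h (fun _ => z) (fun y => T y u v w) x
    - T x (christoffel h x z u) v w - T x u (christoffel h x z v) w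
    - T x u v (christoffel h x z w)

/-- The covariant derivative `(∇_z B)(u, v)` of a tensor field of type `(0, 2)`. -/
noncomputable def nablaTwo (h : E → E →L[ℝ] E →L[ℝ] ℝ) (B : E → E → E → ℝ) (x z u v : E) : ℝ :=
  fderiv ℝ (fun y => B y u v) x z - B x (christoffel h x z u) v - B x u (christoffel h x z v)

/-- The gradient of a function. -/
noncomputable def grad (h : E → E →L[ℝ] E →L[ℝ] ℝ) (φ : E → ℝ) (x : E) : E :=
  sharp h x (fderiv ℝ φ x)

/-- The Hessian `H^φ(u, v) = h(∇_u grad φ, v)`. -/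
noncomputable def hessian (h : E → E →L[ℝ] E →L[ℝ] ℝ) (φ : E → ℝ) (x u v : E) : ℝ :=
  h x (covDeriv h (fun _ => u) (grad h φ) x) v

end Local

/-- The pullback `(v, w) ↦ b(A v, A w)` of a bilinear form `b` along a linear map `A`. -/
noncomputable def pullbackForm {E F : Type*} [NormedAddCommGroup E] [NormedSpace ℝ E]
    [NormedAddCommGroup F] [NormedSpace ℝ F] (b : F →L[ℝ] F →L[ℝ] ℝ) (A : E →L[ℝ] F) :
    E →L[ℝ] E →L[ℝ] ℝ :=
  b.bilinearComp A A

/-! ### Pseudo-Riemannian manifolds -/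

section Manifold

variable {E : Type*} [NormedAddCommGroup E] [NormedSpace ℝ E]
  {H : Type*} [TopologicalSpace H] (I : ModelWithCorners ℝ E H)
  {M : Type*} [TopologicalSpace M] [ChartedSpace H M]

/-- `g` is a pseudo-Riemannian metric on `M`: a smooth field of nondegenerate symmetric bilinear
forms on the tangent spaces.  (The index is then constant on connected components.) -/
structure IsPseudoRiemannianMetric [IsManifold I ∞ M]
    (g : ∀ p : M, TangentSpace I p →L[ℝ] TangentSpace I p →L[ℝ] ℝ) : Prop where
  symm : ∀ (p : M) (v w : TangentSpace I p), g p v w = g p w v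
  nondegenerate : ∀ (p : M) (v : TangentSpace I p), (∀ w, g p v w = 0) → v = 0
  contMDiff : ContMDiff I (I.prod 𝓘(ℝ, E →L[ℝ] E →L[ℝ] ℝ)) ∞
    (fun p => Bundle.TotalSpace.mk' (E →L[ℝ] E →L[ℝ] ℝ)
      (E := fun p : M => TangentSpace I p →L[ℝ] TangentSpace I p →L[ℝ] ℝ) p (g p))

/-- The metric `g` read in the chart `e`, i.e. pulled back along the inverse of the chart. -/
noncomputable def metricInChart
    (g : ∀ p : M, TangentSpace I p →L[ℝ] TangentSpace I p →L[ℝ] ℝ)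
    (e : OpenPartialHomeomorph M H) (y : E) : E →L[ℝ] E →L[ℝ] ℝ :=
  pullbackForm (E := E) (F := E) (g ((e.extend I).symm y))
    (mfderiv 𝓘(ℝ, E) I (e.extend I).symm y)

/-- `∇R = 0` (in every chart of the atlas). -/
def IsLocallySymmetric
    (g : ∀ p : M, TangentSpace I p →L[ℝ] TangentSpace I p →L[ℝ] ℝ) : Prop :=
  ∀ e ∈ atlas H M, ∀ y ∈ (e.extend I).target, ∀ z u v w : E,
    nablaThree (metricInChart I g e) (curvature (metricInChart I g e)) y z u v w = 0

/-- `∇C = 0` (in every chart of the atlas). -/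
def IsConcircularlySymmetric [FiniteDimensional ℝ E]
    (g : ∀ p : M, TangentSpace I p →L[ℝ] TangentSpace I p →L[ℝ] ℝ) : Prop :=
  ∀ e ∈ atlas H M, ∀ y ∈ (e.extend I).target, ∀ z u v w : E,
    nablaThree (metricInChart I g e) (concircular (metricInChart I g e)) y z u v w = 0

/-- `R(u, v)w = κ (g(u, w) v - g(v, w) u)` with one constant `κ` on the whole manifold. -/
def HasConstantCurvature
    (g : ∀ p : M, TangentSpace I p →L[ℝ] TangentSpace I p →L[ℝ] ℝ) : Prop :=
  ∃ κ : ℝ, ∀ e ∈ atlas H M, ∀ y ∈ (e.extend I).target, ∀ u v w : E,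
    curvature (metricInChart I g e) y u v w = κ • tensorG (metricInChart I g e) y u v w

/-- The tensor `F = (1/f) H^f`, read in the chart `e`. -/
noncomputable def tensorF (g : ∀ p : M, TangentSpace I p →L[ℝ] TangentSpace I p →L[ℝ] ℝ)
    (f : M → ℝ) (e : OpenPartialHomeomorph M H) (y u v : E) : ℝ :=
  1 / f ((e.extend I).symm y) *
    hessian (metricInChart I g e) (fun y' => f ((e.extend I).symm y')) y u v

/-- The tensor `F = (1/f) H^f` is parallel: `∇F = 0` (in every chart of the atlas). -/
def IsParallelTensorF
    (g : ∀ p : M, TangentSpace I p →L[ℝ] TangentSpace I p →L[ℝ] ℝ) (f : M → ℝ) : Prop :=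
  ∀ e ∈ atlas H M, ∀ y ∈ (e.extend I).target, ∀ z u v : E,
    nablaTwo (metricInChart I g e) (tensorF I g f e) y z u v = 0

end Manifold

section WarpedProduct

variable {E₁ : Type*} [NormedAddCommGroup E₁] [NormedSpace ℝ E₁]
  {H₁ : Type*} [TopologicalSpace H₁] (I₁ : ModelWithCorners ℝ E₁ H₁)
  {M₁ : Type*} [TopologicalSpace M₁] [ChartedSpace H₁ M₁]
  {E₂ : Type*} [NormedAddCommGroup E₂] [NormedSpace ℝ E₂]
  {H₂ : Type*} [TopologicalSpace H₂] (I₂ : ModelWithCorners ℝ E₂ H₂)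
  {M₂ : Type*} [TopologicalSpace M₂] [ChartedSpace H₂ M₂]

/-- The warped product metric `π₁^* g₁ + (f ∘ π₁)² π₂^* g₂` on `M₁ × M₂`. -/
noncomputable def warpedMetric
    (g₁ : ∀ p : M₁, TangentSpace I₁ p →L[ℝ] TangentSpace I₁ p →L[ℝ] ℝ)
    (g₂ : ∀ q : M₂, TangentSpace I₂ q →L[ℝ] TangentSpace I₂ q →L[ℝ] ℝ)
    (f : M₁ → ℝ) (x : M₁ × M₂) :
    TangentSpace (I₁.prod I₂) x →L[ℝ] TangentSpace (I₁.prod I₂) x →L[ℝ] ℝ :=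
  pullbackForm (E := E₁ × E₂) (F := E₁) (g₁ x.1) (mfderiv (I₁.prod I₂) I₁ Prod.fst x) +
    (f x.1 ^ 2) •
      pullbackForm (E := E₁ × E₂) (F := E₂) (g₂ x.2) (mfderiv (I₁.prod I₂) I₂ Prod.snd x)

end WarpedProduct

end PseudoRiem

/-! Work in a product chart and let σ = τ/(n(n-1)). The tensor G is built from the metric alone, so
it is parallel (`nablaThree_tensorG`), and ∇C = 0 becomes ∇R = dσ ⊗ G. The second Bianchi identity
(`bianchi`) then says that the cyclic sum of dσ(z) G(u, v)w over z, u, v vanishes. In dimension at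
least three there are enough independent vectors to force dσ = 0 (`nablaThree_curvature_eq_zero`).
Hence ∇R = 0 on the warped product, and scalar curvature plays no further role.

The rest is reading off components of ∇R = 0. The Christoffel symbols of h₁ + φ² h₂
(`christoffel_eq`) give its curvature (`curvature_fst`, `curvature_snd`), and then: all arguments
horizontal: the horizontal part is ∇¹R₁ (`nablaThree_base`); all arguments vertical: the vertical
part is ∇²R₂, because |grad φ|² is constant along the fiber and G₂ is parallel (`nablaThree_fiber`);
only the second curvature argument v vertical: the vertical part is -(∇F) v, so F is parallel
(`nablaThree_mixed`); only the last argument w horizontal: the vertical part makes dφ(w) R₂ a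
multiple of G₂ with a coefficient from the base (`nablaThree_fiber_base`). A single base point with
dφ ≠ 0 therefore gives one constant for the whole fiber (`curvature_fiber_eq`); it exists when f is
not constant on a connected base (`exists_fderiv_ne_zero`). -/

namespace PseudoRiem

/-! ### Levi-Civita calculus in a coordinate domain, up to the second Bianchi identity. -/

section LocalMetric

set_option maxSynthPendingDepth 6

variable {E : Type*} [NormedAddCommGroup E] [NormedSpace ℝ E]

/-- `h` restricts to a smooth field of nondegenerate symmetric bilinear forms on the open
set `U`. -/
structure IsMetricOn (h : E → E →L[ℝ] E →L[ℝ] ℝ) (U : Set E) : Prop where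
  isOpen : IsOpen U
  contDiffOn : ContDiffOn ℝ ∞ h U
  symm : ∀ x ∈ U, ∀ v w, h x v w = h x w v
  nondegenerate : ∀ x ∈ U, ∀ v, (∀ w, h x v w = 0) → v = 0

/-- The Christoffel map as a continuous bilinear map. -/
noncomputable def christoffelCLM [FiniteDimensional ℝ E] (h : E → E →L[ℝ] E →L[ℝ] ℝ) (x : E) :
    E →L[ℝ] E →L[ℝ] E :=
  LinearMap.toContinuousLinearMap <| LinearMap.toContinuousLinearMap.toLinearMap ∘ₗ
    LinearMap.mk₂ ℝ (christoffel h x)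
      (fun u u' v => by
        simp only [christoffel, sharp, ← map_add, ← smul_add]
        congr 2; ext w; simp; ring)
      (fun c u v => by
        simp only [christoffel, sharp, ← map_smul, smul_comm c (1 / 2 : ℝ)]
        congr 2; ext w; simp; ring)
      (fun u v v' => by
        simp only [christoffel, sharp, ← map_add, ← smul_add]
        congr 2; ext w; simp; ring)
      (fun c u v => by
        simp only [christoffel, sharp, ← map_smul, smul_comm c (1 / 2 : ℝ)]
        congr 2; ext w; simp; ring)

@[simp]
theorem christoffelCLM_apply [FiniteDimensional ℝ E] (h : E → E →L[ℝ] E →L[ℝ] ℝ) (x u v : E) :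
    christoffelCLM h x u v = christoffel h x u v := rfl

/-- Derivatives of a differentiable family of bilinear maps may be evaluated pointwise. -/
theorem fderiv_apply₂ {E₁ E₂ F G : Type*} [NormedAddCommGroup E₁] [NormedSpace ℝ E₁]
    [NormedAddCommGroup E₂] [NormedSpace ℝ E₂] [NormedAddCommGroup F] [NormedSpace ℝ F]
    [NormedAddCommGroup G] [NormedSpace ℝ G] {B : E₁ → E₂ →L[ℝ] F →L[ℝ] G}
    {x : E₁} (hB : DifferentiableAt ℝ B x) (z : E₁) (u : E₂) (v : F) :
    fderiv ℝ (fun y => B y u v) x z = fderiv ℝ B x z u v := by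
  have h1 : HasFDerivAt (fun y => B y u) ((fderiv ℝ B x).flip u) x := by
    simpa using hB.hasFDerivAt.clm_apply (hasFDerivAt_const u x)
  have h2 : HasFDerivAt (fun y => B y u v) (((fderiv ℝ B x).flip u).flip v) x := by
    simpa using h1.clm_apply (hasFDerivAt_const v x)
  rw [h2.fderiv]; simp

theorem covDeriv_const (h : E → E →L[ℝ] E →L[ℝ] ℝ) (u v : E) :
    covDeriv h (fun _ => u) (fun _ => v) = fun x => christoffel h x u v := by
  ext x; simp [covDeriv]

namespace IsMetricOn

variable {h : E → E →L[ℝ] E →L[ℝ] ℝ} {U : Set E} {x : E}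

theorem ext (H : IsMetricOn h U) (hx : x ∈ U) {v v' : E} (hv : ∀ w, h x v w = h x v' w) :
    v = v' :=
  sub_eq_zero.1 (H.nondegenerate x hx _ fun w => by simp [hv])

theorem differentiableAt (H : IsMetricOn h U) (hx : x ∈ U) : DifferentiableAt ℝ h x :=
  ((H.contDiffOn x hx).contDiffAt (H.isOpen.mem_nhds hx)).differentiableAt (by simp)

theorem fderiv_symm (H : IsMetricOn h U) (hx : x ∈ U) (z v w : E) :
    fderiv ℝ h x z v w = fderiv ℝ h x z w v := by
  rw [← fderiv_apply₂ (H.differentiableAt hx), ← fderiv_apply₂ (H.differentiableAt hx)]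
  refine DFunLike.congr_fun (Filter.EventuallyEq.fderiv_eq ?_) z
  filter_upwards [H.isOpen.mem_nhds hx] with y hy using H.symm y hy v w

theorem contDiffOn_fderiv (H : IsMetricOn h U) : ContDiffOn ℝ ∞ (fderiv ℝ h) U :=
  H.contDiffOn.fderiv_of_isOpen H.isOpen (by simp)

variable [FiniteDimensional ℝ E]

/-- Nondegeneracy is injectivity into the dual, which has the same finite dimension. This is what
makes `sharp` meaningful, since `ContinuousLinearMap.inverse` is zero on non-invertible maps. -/
theorem isInvertible (H : IsMetricOn h U) (hx : x ∈ U) : (h x).IsInvertible := by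
  have hinj : Function.Injective (h x : E →ₗ[ℝ] E →L[ℝ] ℝ) := fun v v' hv =>
    H.ext hx fun w => DFunLike.congr_fun hv w
  have hdim : Module.finrank ℝ E = Module.finrank ℝ (E →L[ℝ] ℝ) := by
    rw [← (LinearMap.toContinuousLinearMap (𝕜 := ℝ) (E := E) (F' := ℝ)).finrank_eq]
    exact Subspace.dual_finrank_eq.symm
  refine ⟨(LinearEquiv.ofInjectiveOfFinrankEq _ hinj hdim).toContinuousLinearEquiv, ?_⟩
  ext; rfl

theorem apply_sharp (H : IsMetricOn h U) (hx : x ∈ U) (α : E →L[ℝ] ℝ) :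
    h x (sharp h x α) = α := by
  obtain ⟨e, he⟩ := H.isInvertible hx
  simp [sharp, ← he]

theorem contDiffOn_sharp (H : IsMetricOn h U) {α : E → E →L[ℝ] ℝ} (hα : ContDiffOn ℝ ∞ α U) :
    ContDiffOn ℝ ∞ (fun x => sharp h x (α x)) U := by
  have : CompleteSpace E := FiniteDimensional.complete ℝ E
  refine ContDiffOn.clm_apply (fun x hx => ?_) hα
  exact (H.isInvertible hx).contDiffAt_map_inverse.comp_contDiffWithinAt x (H.contDiffOn x hx)

theorem apply_christoffel (H : IsMetricOn h U) (hx : x ∈ U) (u v w : E) :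
    h x (christoffel h x u v) w =
      1 / 2 * (fderiv ℝ h x u v w + fderiv ℝ h x v u w - fderiv ℝ h x w u v) := by
  simp [christoffel, H.apply_sharp hx]

theorem christoffel_comm (H : IsMetricOn h U) (hx : x ∈ U) (u v : E) :
    christoffel h x u v = christoffel h x v u := by
  refine H.ext hx fun w => ?_
  rw [H.apply_christoffel hx, H.apply_christoffel hx, H.fderiv_symm hx w u v]
  ring

/-- The Levi-Civita connection is compatible with the metric. -/
theorem fderiv_apply (H : IsMetricOn h U) (hx : x ∈ U) (z u v : E) :
    fderiv ℝ h x z u v = h x (christoffel h x z u) v + h x u (christoffel h x z v) := by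
  rw [H.symm x hx u, H.apply_christoffel hx, H.apply_christoffel hx,
    H.fderiv_symm hx z v u]
  ring

theorem contDiffOn_christoffelCLM (H : IsMetricOn h U) :
    ContDiffOn ℝ ∞ (christoffelCLM h) U := by
  refine contDiffOn_clm_apply.2 fun u => contDiffOn_clm_apply.2 fun v => ?_
  refine H.contDiffOn_sharp (contDiffOn_clm_apply.2 fun w => ?_)
  have hD (a b c : E) : ContDiffOn ℝ ∞ (fun x => fderiv ℝ h x a b c) U :=
    contDiffOn_clm_apply.1 (contDiffOn_clm_apply.1 (contDiffOn_clm_apply.1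
      H.contDiffOn_fderiv a) b) c
  simpa using contDiffOn_const.mul (((hD u v w).add (hD v u w)).sub (hD w u v))

theorem differentiableAt_christoffelCLM (H : IsMetricOn h U) (hx : x ∈ U) :
    DifferentiableAt ℝ (christoffelCLM h) x :=
  ((H.contDiffOn_christoffelCLM x hx).contDiffAt (H.isOpen.mem_nhds hx)).differentiableAt (by simp)

theorem fderiv_christoffel_comm (H : IsMetricOn h U) (hx : x ∈ U) (z u v : E) :
    fderiv ℝ (christoffelCLM h) x z u v = fderiv ℝ (christoffelCLM h) x z v u := by
  have hd := H.differentiableAt_christoffelCLM hx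
  rw [← fderiv_apply₂ hd, ← fderiv_apply₂ hd]
  refine DFunLike.congr_fun (Filter.EventuallyEq.fderiv_eq ?_) z
  filter_upwards [H.isOpen.mem_nhds hx] with y hy using H.christoffel_comm hy u v

end IsMetricOn

theorem covDeriv_zero_left [FiniteDimensional ℝ E] (h : E → E →L[ℝ] E →L[ℝ] ℝ) (W : E → E)
    (x : E) : covDeriv h (fun _ => 0) W x = 0 := by
  simp [covDeriv, ← christoffelCLM_apply]

/-- Coordinate fields commute, so the bracket term drops out. -/
theorem curvature_eq_fderiv_christoffel [FiniteDimensional ℝ E] (h : E → E →L[ℝ] E →L[ℝ] ℝ)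
    (x u v w : E) :
    curvature h x u v w =
      (fderiv ℝ (fun y => christoffel h y u w) x v + christoffel h x v (christoffel h x u w)) -
      (fderiv ℝ (fun y => christoffel h y v w) x u + christoffel h x u (christoffel h x v w)) := by
  have hb : VectorField.lieBracket ℝ (fun _ : E => u) (fun _ => v) = fun _ => 0 := by
    ext y; simp [VectorField.lieBracket]
  rw [curvature, curvatureField, hb, covDeriv_zero_left, covDeriv_const, covDeriv_const, add_zero]
  rfl

namespace IsMetricOn

variable [FiniteDimensional ℝ E] {h : E → E →L[ℝ] E →L[ℝ] ℝ} {U : Set E} {x : E}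

/-- With the Christoffel map as a bilinear-map-valued function, multilinearity and smoothness of the
curvature become visible, and it can be differentiated again. -/
theorem curvature_eq (H : IsMetricOn h U) (hx : x ∈ U) (u v w : E) :
    curvature h x u v w =
      fderiv ℝ (christoffelCLM h) x v u w - fderiv ℝ (christoffelCLM h) x u v w +
      christoffelCLM h x v (christoffelCLM h x u w) -
      christoffelCLM h x u (christoffelCLM h x v w) := by
  have hd := H.differentiableAt_christoffelCLM hx
  rw [curvature_eq_fderiv_christoffel, ← fderiv_apply₂ hd, ← fderiv_apply₂ hd]
  simp only [christoffelCLM_apply]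
  abel

theorem contDiffOn_christoffel (H : IsMetricOn h U) (u v : E) :
    ContDiffOn ℝ ∞ (fun x => christoffel h x u v) U :=
  contDiffOn_clm_apply.1 (contDiffOn_clm_apply.1 H.contDiffOn_christoffelCLM u) v

theorem contDiffOn_curvature (H : IsMetricOn h U) (u v w : E) :
    ContDiffOn ℝ ∞ (fun x => curvature h x u v w) U := by
  have hG := H.contDiffOn_christoffelCLM
  have hD : ContDiffOn ℝ ∞ (fderiv ℝ (christoffelCLM h)) U :=
    hG.fderiv_of_isOpen H.isOpen (by simp)
  have hD' (a b c : E) : ContDiffOn ℝ ∞ (fun x => fderiv ℝ (christoffelCLM h) x a b c) U :=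
    contDiffOn_clm_apply.1 (contDiffOn_clm_apply.1 (contDiffOn_clm_apply.1 hD a) b) c
  have hG' (a b c : E) :
      ContDiffOn ℝ ∞ (fun x => christoffelCLM h x a (christoffelCLM h x b c)) U :=
    (contDiffOn_clm_apply.1 hG a).clm_apply (H.contDiffOn_christoffel b c)
  exact ((((hD' v u w).sub (hD' u v w)).add (hG' v u w)).sub (hG' u v w)).congr
    fun x hx => H.curvature_eq hx u v w

theorem contDiffOn_scalarCurvature (H : IsMetricOn h U) :
    ContDiffOn ℝ ∞ (scalarCurvature h) U := by
  have hc (i) {W : E → E} (hW : ContDiffOn ℝ ∞ W U) :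
      ContDiffOn ℝ ∞ (fun x => (Module.finBasis ℝ E).coord i (W x)) U :=
    (LinearMap.toContinuousLinearMap ((Module.finBasis ℝ E).coord i)).contDiff.comp_contDiffOn hW
  refine ContDiffOn.sum fun i _ => ContDiffOn.sum fun j _ => ContDiffOn.mul ?_ ?_
  · exact hc i (H.contDiffOn_sharp contDiffOn_const)
  · exact ContDiffOn.sum fun k _ => hc k (H.contDiffOn_curvature _ _ _)

/-- The second Bianchi identity. -/
theorem bianchi (H : IsMetricOn h U) (hx : x ∈ U) (z u v w : E) :
    nablaThree h (curvature h) x z u v w + nablaThree h (curvature h) x u v z w +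
      nablaThree h (curvature h) x v z u w = 0 := by
  have hG := (H.contDiffOn_christoffelCLM x hx).contDiffAt (H.isOpen.mem_nhds hx)
  have hGd := H.differentiableAt_christoffelCLM hx
  have hDd : DifferentiableAt ℝ (fderiv ℝ (christoffelCLM h)) x :=
    (hG.fderiv_right (m := ∞) (by simp)).differentiableAt (by simp)
  set Γ := christoffelCLM h with hΓ
  set D := fderiv ℝ Γ x with hD
  set D2 := fderiv ℝ (fderiv ℝ Γ) x with hD2
  -- Schwarz's theorem for the second derivative of the Christoffel map.
  have hsymm (a b c d : E) : D2 a b c d = D2 b a c d := by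
    have := (hG.isSymmSndFDerivAt (by
      simpa using WithTop.coe_le_coe.2 (le_top : (2 : ℕ∞) ≤ ⊤))) a b
    rw [this]
  have hΓc (a b : E) : Γ x a b = Γ x b a := H.christoffel_comm hx a b
  have hDc (a b c : E) : D a b c = D a c b := H.fderiv_christoffel_comm hx a b c
  have hderiv (a b c d : E) : fderiv ℝ (fun y => curvature h y a b c) x d =
      D2 d b a c - D2 d a b c + (D d b (Γ x a c) + Γ x b (D d a c)) -
        (D d a (Γ x b c) + Γ x a (D d b c)) := by
    have e1 : (fun y => curvature h y a b c) =ᶠ[nhds x] fun y =>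
        fderiv ℝ Γ y b a c - fderiv ℝ Γ y a b c + Γ y b (Γ y a c) - Γ y a (Γ y b c) := by
      filter_upwards [H.isOpen.mem_nhds hx] with y hy using H.curvature_eq hy a b c
    have k0 (p : E) : HasFDerivAt (fun y => Γ y p) (D.flip p) x := by
      simpa using hGd.hasFDerivAt.clm_apply (hasFDerivAt_const p x)
    have k1 (p q : E) : HasFDerivAt (fun y => Γ y p q) ((D.flip p).flip q) x := by
      simpa using (k0 p).clm_apply (hasFDerivAt_const q x)
    have k2 (p q r : E) := (k0 p).clm_apply (k1 q r)
    have k3 (p q r : E) : HasFDerivAt (fun y => fderiv ℝ Γ y p q r)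
        (((D2.flip p).flip q).flip r) x := by
      have a1 : HasFDerivAt (fun y => fderiv ℝ Γ y p) (D2.flip p) x := by
        simpa using hDd.hasFDerivAt.clm_apply (hasFDerivAt_const p x)
      have a2 : HasFDerivAt (fun y => fderiv ℝ Γ y p q) ((D2.flip p).flip q) x := by
        simpa using a1.clm_apply (hasFDerivAt_const q x)
      simpa using a2.clm_apply (hasFDerivAt_const r x)
    rw [e1.fderiv_eq,
      ((((k3 b a c).fun_sub (k3 a b c)).fun_add (k2 b a c)).fun_sub (k2 a b c)).fderiv]
    simp
    abel
  have hR (a b c : E) : curvature h x a b c =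
      D b a c - D a b c + Γ x b (Γ x a c) - Γ x a (Γ x b c) := H.curvature_eq hx a b c
  simp only [nablaThree, covDeriv, ← christoffelCLM_apply, ← hΓ, hderiv, hR, map_add, map_sub]
  -- Second derivatives cancel in pairs by Schwarz; the remaining terms cancel once the lower
  -- arguments of Γ and of its derivative are put in a common order.
  rw [hsymm u z v w, hsymm v z u w, hsymm v u z w, hΓc u z, hΓc v z, hΓc v u]
  rw [hDc (Γ x z u), hDc (Γ x z v), hDc (Γ x u v)]
  simp only [hDc _ (Γ x _ _)]
  abel

end IsMetricOn

end LocalMetric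

/-! ### Concircular symmetry implies local symmetry in dimension at least three. -/

section Concircular

namespace IsMetricOn

variable {E : Type*} [NormedAddCommGroup E] [NormedSpace ℝ E]
  {h : E → E →L[ℝ] E →L[ℝ] ℝ} {U : Set E} {x : E}

theorem hasFDerivAt_apply (H : IsMetricOn h U) (hx : x ∈ U) (u v : E) :
    HasFDerivAt (fun y => h y u v) (((fderiv ℝ h x).flip u).flip v) x := by
  have h1 : HasFDerivAt (fun y => h y u) ((fderiv ℝ h x).flip u) x := by
    simpa using (H.differentiableAt hx).hasFDerivAt.clm_apply (hasFDerivAt_const u x)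
  simpa using h1.clm_apply (hasFDerivAt_const v x)

theorem hasFDerivAt_tensorG (H : IsMetricOn h U) (hx : x ∈ U) (u v w : E) :
    HasFDerivAt (fun y => tensorG h y u v w)
      ((((fderiv ℝ h x).flip u).flip w).smulRight v -
        (((fderiv ℝ h x).flip v).flip w).smulRight u) x :=
  ((H.hasFDerivAt_apply hx u w).smul_const v).sub ((H.hasFDerivAt_apply hx v w).smul_const u)

variable [FiniteDimensional ℝ E]

/-- Metric compatibility turns each derivative of h into two Christoffel terms, which cancel against
the correction terms. -/
theorem nablaThree_tensorG (H : IsMetricOn h U) (hx : x ∈ U) (z u v w : E) :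
    nablaThree h (tensorG h) x z u v w = 0 := by
  simp only [nablaThree, covDeriv, (H.hasFDerivAt_tensorG hx u v w).fderiv,
    ← christoffelCLM_apply]
  simp only [tensorG, map_sub, map_smul, sub_apply,
    ContinuousLinearMap.smulRight_apply, ContinuousLinearMap.flip_apply, H.fderiv_apply hx,
    christoffelCLM_apply]
  module

/-- For a concircularly symmetric metric, `∇R` is `G` multiplied by the differential of the
normalized scalar curvature. -/
theorem nablaThree_curvature_of_concircular (H : IsMetricOn h U) (hx : x ∈ U) {z u v w : E}
    (hC : nablaThree h (concircular h) x z u v w = 0) :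
    nablaThree h (curvature h) x z u v w =
      fderiv ℝ (fun y => scalarCurvature h y /
        ((Module.finrank ℝ E : ℝ) * ((Module.finrank ℝ E : ℝ) - 1))) x z •
        tensorG h x u v w := by
  have hR : DifferentiableAt ℝ (fun y => curvature h y u v w) x :=
    ((H.contDiffOn_curvature u v w x hx).contDiffAt (H.isOpen.mem_nhds hx)).differentiableAt
      (by simp)
  have hs : DifferentiableAt ℝ (fun y => scalarCurvature h y /
      ((Module.finrank ℝ E : ℝ) * ((Module.finrank ℝ E : ℝ) - 1))) x :=
    ((((H.contDiffOn_scalarCurvature).div_const _ x hx).contDiffAt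
      (H.isOpen.mem_nhds hx)).differentiableAt (by simp))
  have hG := H.nablaThree_tensorG hx z u v w
  have hd := H.hasFDerivAt_tensorG hx u v w
  set s : E → ℝ := fun y => scalarCurvature h y /
    ((Module.finrank ℝ E : ℝ) * ((Module.finrank ℝ E : ℝ) - 1)) with hs'
  have hCs (a b c : E) :
      (fun y => concircular h y a b c) = fun y => curvature h y a b c - s y • tensorG h y a b c :=
    rfl
  have hder := (hR.hasFDerivAt.fun_sub (hs.hasFDerivAt.fun_smul hd)).fderiv
  simp only [nablaThree, covDeriv, hd.fderiv, ← christoffelCLM_apply] at hG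
  simp only [nablaThree, covDeriv, hCs, hder, ← christoffelCLM_apply,
    fun a b c => congrFun (hCs a b c) x] at hC
  simp only [nablaThree, covDeriv, ← christoffelCLM_apply]
  simp only [sub_apply, add_apply,
    smul_apply, ContinuousLinearMap.smulRight_apply, map_sub, map_smul]
    at hC hG ⊢
  -- By the Leibniz rule ∇(R - sG) = ∇R - ds ⊗ G - s ∇G, and ∇G = 0.
  linear_combination (norm := module) hC + s x • hG

theorem _root_.exists_linearIndependent_triple {V : Type*} [AddCommGroup V] [Module ℝ V]
    (hn : 3 ≤ Module.finrank ℝ V) {u : V} (hu : u ≠ 0) :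
    ∃ z v : V, LinearIndependent ℝ ![z, v, u] := by
  have h1 : LinearIndependent ℝ ![u] := linearIndependent_unique_iff.2 (by simpa using hu)
  obtain ⟨v, hv⟩ := exists_linearIndependent_cons_of_lt_finrank h1 (by omega)
  obtain ⟨z, hz⟩ := exists_linearIndependent_cons_of_lt_finrank hv (by omega)
  exact ⟨z, v, hz⟩

/-- In dimension at least three, concircularly symmetric metrics are locally symmetric. -/
theorem nablaThree_curvature_eq_zero (H : IsMetricOn h U) (hx : x ∈ U)
    (hn : 3 ≤ Module.finrank ℝ E)
    (hC : ∀ z u v w, nablaThree h (concircular h) x z u v w = 0) (z u v w : E) :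
    nablaThree h (curvature h) x z u v w = 0 := by
  have key := fun z u v w => H.nablaThree_curvature_of_concircular hx (hC z u v w)
  set σ := fderiv ℝ (fun y => scalarCurvature h y /
        ((Module.finrank ℝ E : ℝ) * ((Module.finrank ℝ E : ℝ) - 1))) x
  suffices hσ : σ z = 0 by rw [key, hσ, zero_smul]
  by_cases hz : z = 0
  · rw [hz, map_zero]
  -- The given vector z is the last of the independent triple, in the order a, b, z.
  obtain ⟨a, b, hab⟩ := exists_linearIndependent_triple hn hz
  have hli := Fintype.linearIndependent_iff.1 hab
  have hb (w : E) := H.bianchi hx z a b w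
  simp only [key, tensorG] at hb
  -- The coefficient of b in the Bianchi sum is h(σ(z) a - σ(a) z, w), which vanishes for every w.
  -- Independence of a and z then gives σ(z) = 0.
  have h0 : σ z • a - σ a • z = 0 := by
    refine H.nondegenerate x hx _ fun w => ?_
    have := hli ![σ b * h x z w - σ z * h x b w, σ z * h x a w - σ a * h x z w,
      σ a * h x b w - σ b * h x a w] (by
        rw [← hb w]; simp [Fin.sum_univ_three]; module) 1
    simpa using this
  simpa using hli ![σ z, 0, -σ a] (by rw [← h0]; simp [Fin.sum_univ_three]; module) 0

end IsMetricOn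

end Concircular

/-! ### Hessians, and the Levi-Civita connection of a warped product. -/

section Warped

set_option maxSynthPendingDepth 6

variable {E : Type*} [NormedAddCommGroup E] [NormedSpace ℝ E]
  {h : E → E →L[ℝ] E →L[ℝ] ℝ} {U : Set E} {x : E} {φ : E → ℝ}

namespace IsMetricOn

theorem contDiffOn_fderiv_real (H : IsMetricOn h U) (hφ : ContDiffOn ℝ ∞ φ U) :
    ContDiffOn ℝ ∞ (fderiv ℝ φ) U :=
  hφ.fderiv_of_isOpen H.isOpen (by simp)

theorem differentiableAt_of_contDiffOn {F : Type*} [NormedAddCommGroup F] [NormedSpace ℝ F]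
    (H : IsMetricOn h U) (hx : x ∈ U) {W : E → F} (hW : ContDiffOn ℝ ∞ W U) :
    DifferentiableAt ℝ W x :=
  ((hW x hx).contDiffAt (H.isOpen.mem_nhds hx)).differentiableAt (by simp)

variable [FiniteDimensional ℝ E]

theorem curvature_zero_left (H : IsMetricOn h U) (hx : x ∈ U) (v w : E) :
    curvature h x 0 v w = 0 := by
  simp [H.curvature_eq hx, -christoffelCLM_apply]

theorem curvature_zero_right (H : IsMetricOn h U) (hx : x ∈ U) (u v : E) :
    curvature h x u v 0 = 0 := by
  simp [H.curvature_eq hx, -christoffelCLM_apply]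

theorem curvature_smul_right (H : IsMetricOn h U) (hx : x ∈ U) (c : ℝ) (u v w : E) :
    curvature h x u v (c • w) = c • curvature h x u v w := by
  simp only [H.curvature_eq hx, map_smul]
  module

theorem contDiffOn_grad (H : IsMetricOn h U) (hφ : ContDiffOn ℝ ∞ φ U) :
    ContDiffOn ℝ ∞ (grad h φ) U :=
  H.contDiffOn_sharp (H.contDiffOn_fderiv_real hφ)

theorem apply_grad (H : IsMetricOn h U) (hx : x ∈ U) (v : E) :
    h x (grad h φ x) v = fderiv ℝ φ x v := by
  simp [grad, H.apply_sharp hx]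

/-- The Hessian in coordinates. -/
theorem hessian_eq (H : IsMetricOn h U) (hx : x ∈ U) (hφ : ContDiffOn ℝ ∞ φ U) (u v : E) :
    hessian h φ x u v = fderiv ℝ (fderiv ℝ φ) x u v - fderiv ℝ φ x (christoffel h x u v) := by
  have ha := (H.differentiableAt_of_contDiffOn hx (H.contDiffOn_grad hφ)).hasFDerivAt
  have hd := (H.differentiableAt_of_contDiffOn hx (H.contDiffOn_fderiv_real hφ)).hasFDerivAt
  have h1 := ((H.differentiableAt hx).hasFDerivAt.clm_apply ha).clm_apply (hasFDerivAt_const v x)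
  have h2 := hd.clm_apply (hasFDerivAt_const v x)
  -- Differentiating h(grad φ, v) = dφ(v) and using metric compatibility produces the Hessian.
  have he : (fun y => h y (grad h φ y) v) =ᶠ[nhds x] fun y => fderiv ℝ φ y v := by
    filter_upwards [H.isOpen.mem_nhds hx] with y hy using H.apply_grad hy v
  have := DFunLike.congr_fun (h1.unique (h2.congr_of_eventuallyEq he)) u
  simp only [add_apply, ContinuousLinearMap.comp_apply,
    ContinuousLinearMap.flip_apply, zero_apply, map_zero, zero_add] at this
  rw [← this, H.fderiv_apply hx, ← H.apply_grad hx]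
  simp [hessian, covDeriv]
  ring

theorem hessian_comm (H : IsMetricOn h U) (hx : x ∈ U) (hφ : ContDiffOn ℝ ∞ φ U) (u v : E) :
    hessian h φ x u v = hessian h φ x v u := by
  rw [H.hessian_eq hx hφ, H.hessian_eq hx hφ, H.christoffel_comm hx u v]
  congr 1
  exact ((hφ x hx).contDiffAt (H.isOpen.mem_nhds hx)).isSymmSndFDerivAt
    (by simpa using WithTop.coe_le_coe.2 (le_top : (2 : ℕ∞) ≤ ⊤)) u v

theorem hessian_smul_left (H : IsMetricOn h U) (hx : x ∈ U) (hφ : ContDiffOn ℝ ∞ φ U) (c : ℝ)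
    (u v : E) : hessian h φ x (c • u) v = c * hessian h φ x u v := by
  simp only [H.hessian_eq hx hφ, ← christoffelCLM_apply, map_smul, smul_apply, smul_eq_mul]
  ring

theorem hessian_zero_left (H : IsMetricOn h U) (hx : x ∈ U) (hφ : ContDiffOn ℝ ∞ φ U) (v : E) :
    hessian h φ x 0 v = 0 := by
  simpa using H.hessian_smul_left hx hφ 0 0 v

theorem hessian_zero_right (H : IsMetricOn h U) (hx : x ∈ U) (hφ : ContDiffOn ℝ ∞ φ U) (v : E) :
    hessian h φ x v 0 = 0 := by
  rw [H.hessian_comm hx hφ, H.hessian_zero_left hx hφ]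

theorem contDiffOn_hessian (H : IsMetricOn h U) (hφ : ContDiffOn ℝ ∞ φ U) (u v : E) :
    ContDiffOn ℝ ∞ (fun y => hessian h φ y u v) U := by
  have hd := H.contDiffOn_fderiv_real hφ
  have hdd : ContDiffOn ℝ ∞ (fderiv ℝ (fderiv ℝ φ)) U := hd.fderiv_of_isOpen H.isOpen (by simp)
  exact ((contDiffOn_clm_apply.1 (contDiffOn_clm_apply.1 hdd u) v).sub
    (hd.clm_apply (H.contDiffOn_christoffel u v))).congr fun y hy => H.hessian_eq hy hφ u v

end IsMetricOn

variable {E₁ : Type*} [NormedAddCommGroup E₁] [NormedSpace ℝ E₁]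
  {E₂ : Type*} [NormedAddCommGroup E₂] [NormedSpace ℝ E₂]

/-- `h` is the warped product metric `h₁ + φ² h₂` on `U₁ × U₂`. -/
structure IsWarpedOn (h : E₁ × E₂ → E₁ × E₂ →L[ℝ] E₁ × E₂ →L[ℝ] ℝ)
    (h₁ : E₁ → E₁ →L[ℝ] E₁ →L[ℝ] ℝ) (h₂ : E₂ → E₂ →L[ℝ] E₂ →L[ℝ] ℝ) (φ : E₁ → ℝ)
    (U₁ : Set E₁) (U₂ : Set E₂) : Prop where
  base : IsMetricOn h₁ U₁
  fiber : IsMetricOn h₂ U₂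
  contDiffOn : ContDiffOn ℝ ∞ φ U₁
  pos : ∀ y ∈ U₁, 0 < φ y
  apply : ∀ y ∈ U₁ ×ˢ U₂, ∀ v w,
    h y v w = h₁ y.1 v.1 w.1 + φ y.1 ^ 2 * h₂ y.2 v.2 w.2

namespace IsWarpedOn

variable {h : E₁ × E₂ → E₁ × E₂ →L[ℝ] E₁ × E₂ →L[ℝ] ℝ}
  {h₁ : E₁ → E₁ →L[ℝ] E₁ →L[ℝ] ℝ} {h₂ : E₂ → E₂ →L[ℝ] E₂ →L[ℝ] ℝ} {φ : E₁ → ℝ}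
  {U₁ : Set E₁} {U₂ : Set E₂} {x : E₁ × E₂}

theorem isOpen (W : IsWarpedOn h h₁ h₂ φ U₁ U₂) : IsOpen (U₁ ×ˢ U₂) :=
  W.base.isOpen.prod W.fiber.isOpen

theorem hasFDerivAt_warping (W : IsWarpedOn h h₁ h₂ φ U₁ U₂) (hx : x ∈ U₁ ×ˢ U₂) :
    HasFDerivAt φ (fderiv ℝ φ x.1) x.1 :=
  (W.base.differentiableAt_of_contDiffOn hx.1 W.contDiffOn).hasFDerivAt

variable [FiniteDimensional ℝ E₁] [FiniteDimensional ℝ E₂]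

theorem isMetricOn (W : IsWarpedOn h h₁ h₂ φ U₁ U₂) : IsMetricOn h (U₁ ×ˢ U₂) where
  isOpen := W.isOpen
  contDiffOn := by
    refine contDiffOn_clm_apply.2 fun v => contDiffOn_clm_apply.2 fun w => ?_
    have m1 : Set.MapsTo (Prod.fst : E₁ × E₂ → E₁) (U₁ ×ˢ U₂) U₁ := fun y hy => hy.1
    have m2 : Set.MapsTo (Prod.snd : E₁ × E₂ → E₂) (U₁ ×ˢ U₂) U₂ := fun y hy => hy.2
    have c1 := (contDiffOn_clm_apply.1 (contDiffOn_clm_apply.1 W.base.contDiffOn v.1) w.1).comp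
      contDiffOn_fst m1
    have c2 := (contDiffOn_clm_apply.1 (contDiffOn_clm_apply.1 W.fiber.contDiffOn v.2) w.2).comp
      contDiffOn_snd m2
    exact (c1.add (((W.contDiffOn.comp contDiffOn_fst m1).pow 2).mul c2)).congr
      fun y hy => W.apply y hy v w
  symm y hy v w := by
    rw [W.apply y hy, W.apply y hy, W.base.symm _ hy.1, W.fiber.symm _ hy.2]
  nondegenerate y hy v hv := by
    have hφ := (W.pos _ hy.1).ne'
    refine Prod.ext (W.base.nondegenerate _ hy.1 _ fun w => ?_)
      (W.fiber.nondegenerate _ hy.2 _ fun w => ?_)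
    · simpa [W.apply y hy] using hv (w, 0)
    · simpa [W.apply y hy, hφ] using hv (0, w)

theorem fderiv_apply (W : IsWarpedOn h h₁ h₂ φ U₁ U₂) (hx : x ∈ U₁ ×ˢ U₂) (u v w : E₁ × E₂) :
    fderiv ℝ h x u v w = fderiv ℝ h₁ x.1 u.1 v.1 w.1 +
      (2 * φ x.1 * fderiv ℝ φ x.1 u.1 * h₂ x.2 v.2 w.2 +
        φ x.1 ^ 2 * fderiv ℝ h₂ x.2 u.2 v.2 w.2) := by
  rw [← fderiv_apply₂ (W.isMetricOn.differentiableAt hx)]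
  have he : (fun y => h y v w) =ᶠ[nhds x] fun y =>
      h₁ y.1 v.1 w.1 + φ y.1 * φ y.1 * h₂ y.2 v.2 w.2 := by
    filter_upwards [W.isOpen.mem_nhds hx] with y hy
    rw [W.apply y hy, pow_two]
  have d1 := (W.base.hasFDerivAt_apply hx.1 v.1 w.1).comp x hasFDerivAt_fst
  have d2 := (W.fiber.hasFDerivAt_apply hx.2 v.2 w.2).comp x hasFDerivAt_snd
  have d3 := (W.hasFDerivAt_warping hx).comp x hasFDerivAt_fst
  have d := d1.fun_add ((d3.fun_mul d3).fun_mul d2)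
  simp only [Function.comp_def] at d
  rw [he.fderiv_eq, d.fderiv]
  simp
  ring

/-- By nondegeneracy it suffices to pair with w and apply the Koszul formula. Differentiating φ²
along u and v gives the two dφ/φ terms; differentiating it along w gives the gradient term. -/
theorem christoffel_eq (W : IsWarpedOn h h₁ h₂ φ U₁ U₂) (hx : x ∈ U₁ ×ˢ U₂) (u v : E₁ × E₂) :
    christoffel h x u v =
      (christoffel h₁ x.1 u.1 v.1 - (φ x.1 * h₂ x.2 u.2 v.2) • grad h₁ φ x.1,
        christoffel h₂ x.2 u.2 v.2 + (fderiv ℝ φ x.1 u.1 / φ x.1) • v.2 +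
          (fderiv ℝ φ x.1 v.1 / φ x.1) • u.2) := by
  have hφ := (W.pos _ hx.1).ne'
  refine W.isMetricOn.ext hx fun w => ?_
  rw [W.isMetricOn.apply_christoffel hx, W.apply x hx]
  simp only [W.fderiv_apply hx, map_sub, map_add, map_smul, sub_apply,
    add_apply, smul_apply, smul_eq_mul, W.base.apply_christoffel hx.1,
    W.fiber.apply_christoffel hx.2, W.base.apply_grad hx.1, W.fiber.symm _ hx.2 u.2 w.2]
  field_simp
  ring

theorem fderiv_christoffel (W : IsWarpedOn h h₁ h₂ φ U₁ U₂) (hx : x ∈ U₁ ×ˢ U₂)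
    (u v z : E₁ × E₂) :
    fderiv ℝ (fun y => christoffel h y u v) x z =
      (fderiv ℝ (fun y => christoffel h₁ y u.1 v.1) x.1 z.1 -
          (fderiv ℝ φ x.1 z.1 * h₂ x.2 u.2 v.2 + φ x.1 * fderiv ℝ h₂ x.2 z.2 u.2 v.2) •
            grad h₁ φ x.1 -
          (φ x.1 * h₂ x.2 u.2 v.2) • fderiv ℝ (grad h₁ φ) x.1 z.1,
        fderiv ℝ (fun y => christoffel h₂ y u.2 v.2) x.2 z.2 +
          (fderiv ℝ (fderiv ℝ φ) x.1 z.1 u.1 / φ x.1 -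
            fderiv ℝ φ x.1 z.1 * fderiv ℝ φ x.1 u.1 / φ x.1 ^ 2) • v.2 +
          (fderiv ℝ (fderiv ℝ φ) x.1 z.1 v.1 / φ x.1 -
            fderiv ℝ φ x.1 z.1 * fderiv ℝ φ x.1 v.1 / φ x.1 ^ 2) • u.2) := by
  have hφ := (W.pos _ hx.1).ne'
  have he : (fun y => christoffel h y u v) =ᶠ[nhds x] fun y =>
      (christoffel h₁ y.1 u.1 v.1 - (φ y.1 * h₂ y.2 u.2 v.2) • grad h₁ φ y.1,
        christoffel h₂ y.2 u.2 v.2 + (fderiv ℝ φ y.1 u.1 * (φ y.1)⁻¹) • v.2 +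
          (fderiv ℝ φ y.1 v.1 * (φ y.1)⁻¹) • u.2) := by
    filter_upwards [W.isOpen.mem_nhds hx] with y hy using W.christoffel_eq hy u v
  have c1 := (W.base.differentiableAt_of_contDiffOn hx.1
    (W.base.contDiffOn_christoffel u.1 v.1)).hasFDerivAt.comp x hasFDerivAt_fst
  have c2 := (W.fiber.differentiableAt_of_contDiffOn hx.2
    (W.fiber.contDiffOn_christoffel u.2 v.2)).hasFDerivAt.comp x hasFDerivAt_snd
  have d0 := (W.hasFDerivAt_warping hx).comp x hasFDerivAt_fst
  have d1 := (W.base.differentiableAt_of_contDiffOn hx.1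
    (W.base.contDiffOn_fderiv_real W.contDiffOn)).hasFDerivAt.comp x hasFDerivAt_fst
  have d2 (p : E₁) := d1.clm_apply (hasFDerivAt_const p x)
  have g1 := (W.base.differentiableAt_of_contDiffOn hx.1
    (W.base.contDiffOn_grad W.contDiffOn)).hasFDerivAt.comp x hasFDerivAt_fst
  have m2 := (W.fiber.hasFDerivAt_apply hx.2 u.2 v.2).comp x hasFDerivAt_snd
  have d3 (p : E₁) := (d2 p).fun_mul ((hasDerivAt_inv hφ).comp_hasFDerivAt x d0)
  have d := (c1.fun_sub ((d0.fun_mul m2).fun_smul g1)).prodMk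
    ((c2.fun_add ((d3 u.1).smul_const v.2)).fun_add ((d3 v.1).smul_const u.2))
  simp only [Function.comp_def] at d
  rw [he.fderiv_eq, d.fderiv]
  simp only [ContinuousLinearMap.prod_apply, add_apply, sub_apply, smul_apply,
    ContinuousLinearMap.smulRight_apply, ContinuousLinearMap.comp_apply,
    ContinuousLinearMap.flip_apply, ContinuousLinearMap.coe_fst', ContinuousLinearMap.coe_snd',
    zero_apply, map_zero, zero_add, smul_eq_mul]
  ext1 <;> dsimp only <;> match_scalars <;> field_simp <;> ring

end IsWarpedOn

end Warped

/-! ### Curvature of a warped product. -/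

section WarpedCurvature

set_option maxSynthPendingDepth 6

variable {E₁ : Type*} [NormedAddCommGroup E₁] [NormedSpace ℝ E₁] [FiniteDimensional ℝ E₁]
  {E₂ : Type*} [NormedAddCommGroup E₂] [NormedSpace ℝ E₂] [FiniteDimensional ℝ E₂]
  {h : E₁ × E₂ → E₁ × E₂ →L[ℝ] E₁ × E₂ →L[ℝ] ℝ}
  {h₁ : E₁ → E₁ →L[ℝ] E₁ →L[ℝ] ℝ} {h₂ : E₂ → E₂ →L[ℝ] E₂ →L[ℝ] ℝ} {φ : E₁ → ℝ}
  {U₁ : Set E₁} {U₂ : Set E₂} {x : E₁ × E₂}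

namespace IsWarpedOn

/-- Derivatives of h₂ are absorbed by metric compatibility of the fiber; what survives besides R₁ is
the covariant derivative of grad φ. -/
theorem curvature_fst (W : IsWarpedOn h h₁ h₂ φ U₁ U₂) (hx : x ∈ U₁ ×ˢ U₂) (u v w : E₁ × E₂) :
    (curvature h x u v w).1 = curvature h₁ x.1 u.1 v.1 w.1 -
      (φ x.1 * h₂ x.2 u.2 w.2) • covDeriv h₁ (fun _ => v.1) (grad h₁ φ) x.1 +
      (φ x.1 * h₂ x.2 v.2 w.2) • covDeriv h₁ (fun _ => u.1) (grad h₁ φ) x.1 := by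
  have hφ := (W.pos _ hx.1).ne'
  simp only [curvature_eq_fderiv_christoffel, W.fderiv_christoffel hx, W.christoffel_eq hx]
  simp only [covDeriv, ← christoffelCLM_apply, map_sub, map_smul, map_add, W.fiber.fderiv_apply hx.2,
    Prod.fst_add, Prod.fst_sub, smul_eq_mul]
  simp only [christoffelCLM_apply, W.fiber.christoffel_comm hx.2 v.2 u.2, W.fiber.symm _ hx.2 v.2]
  rw [W.fiber.symm _ hx.2 u.2 v.2, W.fiber.symm _ hx.2 u.2 (christoffel h₂ x.2 v.2 w.2)]
  match_scalars <;> field_simp <;> ring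

/-- The G₂ term arises when the gradient part of one Christoffel symbol is fed into the dφ/φ part of
another. The Hessians come from differentiating dφ/φ, whose quadratic remainder cancels. -/
theorem curvature_snd (W : IsWarpedOn h h₁ h₂ φ U₁ U₂) (hx : x ∈ U₁ ×ˢ U₂) (u v w : E₁ × E₂) :
    (curvature h x u v w).2 = curvature h₂ x.2 u.2 v.2 w.2 -
      fderiv ℝ φ x.1 (grad h₁ φ x.1) • tensorG h₂ x.2 u.2 v.2 w.2 +
      (1 / φ x.1 * hessian h₁ φ x.1 v.1 w.1) • u.2 -
      (1 / φ x.1 * hessian h₁ φ x.1 u.1 w.1) • v.2 := by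
  have hφ := (W.pos _ hx.1).ne'
  have hdd : fderiv ℝ (fderiv ℝ φ) x.1 v.1 u.1 = fderiv ℝ (fderiv ℝ φ) x.1 u.1 v.1 :=
    ((W.contDiffOn x.1 hx.1).contDiffAt (W.base.isOpen.mem_nhds hx.1)).isSymmSndFDerivAt
    (by simpa using WithTop.coe_le_coe.2 (le_top : (2 : ℕ∞) ≤ ⊤)) v.1 u.1
  simp only [curvature_eq_fderiv_christoffel, W.fderiv_christoffel hx, W.christoffel_eq hx]
  simp only [W.base.hessian_eq hx.1 W.contDiffOn, hdd, tensorG,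
    ← christoffelCLM_apply, map_sub, map_smul, map_add,
    Prod.snd_add, Prod.snd_sub, smul_eq_mul]
  simp only [christoffelCLM_apply, W.fiber.christoffel_comm hx.2 v.2 u.2]
  match_scalars <;> field_simp <;> ring

end IsWarpedOn

end WarpedCurvature

/-! ### Components of ∇R on a warped product. -/

section WarpedSymmetric

theorem fderiv_fst_apply {E F G : Type*} [NormedAddCommGroup E] [NormedSpace ℝ E]
    [NormedAddCommGroup F] [NormedSpace ℝ F] [NormedAddCommGroup G] [NormedSpace ℝ G]
    {f : E → F × G} {x : E} (hf : DifferentiableAt ℝ f x) (z : E) :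
    (fderiv ℝ f x z).1 = fderiv ℝ (fun y => (f y).1) x z := by
  rw [fderiv.fst hf]; rfl

theorem fderiv_snd_apply {E F G : Type*} [NormedAddCommGroup E] [NormedSpace ℝ E]
    [NormedAddCommGroup F] [NormedSpace ℝ F] [NormedAddCommGroup G] [NormedSpace ℝ G]
    {f : E → F × G} {x : E} (hf : DifferentiableAt ℝ f x) (z : E) :
    (fderiv ℝ f x z).2 = fderiv ℝ (fun y => (f y).2) x z := by
  rw [fderiv.snd hf]; rfl

variable {E₁ : Type*} [NormedAddCommGroup E₁] [NormedSpace ℝ E₁] [FiniteDimensional ℝ E₁]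
  {E₂ : Type*} [NormedAddCommGroup E₂] [NormedSpace ℝ E₂] [FiniteDimensional ℝ E₂]
  {h : E₁ × E₂ → E₁ × E₂ →L[ℝ] E₁ × E₂ →L[ℝ] ℝ}
  {h₁ : E₁ → E₁ →L[ℝ] E₁ →L[ℝ] ℝ} {h₂ : E₂ → E₂ →L[ℝ] E₂ →L[ℝ] ℝ} {φ : E₁ → ℝ}
  {U₁ : Set E₁} {U₂ : Set E₂} {x : E₁ × E₂}

namespace IsWarpedOn

theorem nablaThree_fst (W : IsWarpedOn h h₁ h₂ φ U₁ U₂) (hx : x ∈ U₁ ×ˢ U₂) (z u v w : E₁ × E₂) :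
    (nablaThree h (curvature h) x z u v w).1 =
      fderiv ℝ (fun y => (curvature h y u v w).1) x z +
        (christoffel h x z (curvature h x u v w)).1 -
        (curvature h x (christoffel h x z u) v w).1 - (curvature h x u (christoffel h x z v) w).1 -
        (curvature h x u v (christoffel h x z w)).1 := by
  rw [← fderiv_fst_apply (W.isMetricOn.differentiableAt_of_contDiffOn hx
    (W.isMetricOn.contDiffOn_curvature u v w))]
  rfl

theorem nablaThree_snd (W : IsWarpedOn h h₁ h₂ φ U₁ U₂) (hx : x ∈ U₁ ×ˢ U₂) (z u v w : E₁ × E₂) :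
    (nablaThree h (curvature h) x z u v w).2 =
      fderiv ℝ (fun y => (curvature h y u v w).2) x z +
        (christoffel h x z (curvature h x u v w)).2 -
        (curvature h x (christoffel h x z u) v w).2 - (curvature h x u (christoffel h x z v) w).2 -
        (curvature h x u v (christoffel h x z w)).2 := by
  rw [← fderiv_snd_apply (W.isMetricOn.differentiableAt_of_contDiffOn hx
    (W.isMetricOn.contDiffOn_curvature u v w))]
  rfl

theorem nablaThree_base (W : IsWarpedOn h h₁ h₂ φ U₁ U₂) (hx : x ∈ U₁ ×ˢ U₂) (z u v w : E₁) :
    (nablaThree h (curvature h) x (z, 0) (u, 0) (v, 0) (w, 0)).1 =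
      nablaThree h₁ (curvature h₁) x.1 z u v w := by
  have he : (fun y => (curvature h y (u, (0 : E₂)) (v, 0) (w, 0)).1) =ᶠ[nhds x]
      fun y => curvature h₁ y.1 u v w := by
    filter_upwards [W.isOpen.mem_nhds hx] with y hy
    simp [W.curvature_fst hy]
  have hd := (W.base.differentiableAt_of_contDiffOn hx.1
    (W.base.contDiffOn_curvature u v w)).hasFDerivAt.comp x hasFDerivAt_fst
  simp only [Function.comp_def] at hd
  rw [W.nablaThree_fst hx, he.fderiv_eq, hd.fderiv]
  simp [W.curvature_fst hx, W.christoffel_eq hx, nablaThree, covDeriv]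

/-- On vertical vectors the curvature is R₂ - |grad φ|² G₂. The gradient parts of the Christoffel
symbols enter only through Hessians having a zero argument. -/
theorem nablaThree_fiber (W : IsWarpedOn h h₁ h₂ φ U₁ U₂) (hx : x ∈ U₁ ×ˢ U₂) (z u v w : E₂) :
    (nablaThree h (curvature h) x (0, z) (0, u) (0, v) (0, w)).2 =
      nablaThree h₂ (curvature h₂) x.2 z u v w := by
  have hz (p : E₁) : hessian h₁ φ x.1 0 p = 0 := W.base.hessian_zero_left hx.1 W.contDiffOn p
  have hz' (p : E₁) : hessian h₁ φ x.1 p 0 = 0 := W.base.hessian_zero_right hx.1 W.contDiffOn p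
  have he : (fun y => (curvature h y ((0 : E₁), u) (0, v) (0, w)).2) =ᶠ[nhds x]
      fun y => curvature h₂ y.2 u v w - fderiv ℝ φ y.1 (grad h₁ φ y.1) • tensorG h₂ y.2 u v w := by
    filter_upwards [W.isOpen.mem_nhds hx] with y hy
    simp [W.curvature_snd hy, W.base.hessian_zero_left hy.1 W.contDiffOn]
  have hR := (W.fiber.differentiableAt_of_contDiffOn hx.2
    (W.fiber.contDiffOn_curvature u v w)).hasFDerivAt.comp x hasFDerivAt_snd
  have hN := (W.base.differentiableAt_of_contDiffOn hx.1
    ((W.base.contDiffOn_fderiv_real W.contDiffOn).clm_apply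
      (W.base.contDiffOn_grad W.contDiffOn))).hasFDerivAt.comp x hasFDerivAt_fst
  have hG := (W.fiber.hasFDerivAt_tensorG hx.2 u v w).differentiableAt.hasFDerivAt.comp x
    hasFDerivAt_snd
  have hd := hR.fun_sub (hN.fun_smul hG)
  simp only [Function.comp_def] at hd
  have hGz := W.fiber.nablaThree_tensorG hx.2 z u v w
  have h0 : (curvature h x ((0 : E₁), u) (0, v) (0, w)).1 = 0 := by
    simp [W.curvature_fst hx, W.base.curvature_zero_left hx.1, covDeriv_zero_left]
  rw [W.nablaThree_snd hx, he.fderiv_eq, hd.fderiv]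
  simp only [nablaThree, covDeriv] at hGz ⊢
  simp only [W.christoffel_eq hx, W.curvature_snd hx, hz, hz']
  simp [← christoffelCLM_apply, h0] at hGz ⊢
  linear_combination (norm := module) (-fderiv ℝ φ x.1 (grad h₁ φ x.1)) • hGz

/-- Here the curvature is -F(u, w) v. The two terms with factor dφ(z)/φ, one from differentiating
the value and one from differentiating the argument v, cancel. -/
theorem nablaThree_mixed (W : IsWarpedOn h h₁ h₂ φ U₁ U₂) (hx : x ∈ U₁ ×ˢ U₂) (z u w : E₁)
    (v : E₂) :
    (nablaThree h (curvature h) x (z, 0) (u, 0) (0, v) (w, 0)).2 =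
      -(nablaTwo h₁ (fun y u w => 1 / φ y * hessian h₁ φ y u w) x.1 z u w) • v := by
  have he : (fun y => (curvature h y (u, (0 : E₂)) (0, v) (w, 0)).2) =ᶠ[nhds x]
      fun y => (1 / φ y.1 * hessian h₁ φ y.1 u w) • (-v) := by
    filter_upwards [W.isOpen.mem_nhds hx] with y hy
    simp [W.curvature_snd hy, W.fiber.curvature_zero_left hy.2, tensorG]
  have hF : DifferentiableAt ℝ (fun y => 1 / φ y * hessian h₁ φ y u w) x.1 :=
    W.base.differentiableAt_of_contDiffOn hx.1
      ((contDiffOn_const.div W.contDiffOn fun y hy => (W.pos y hy).ne').mul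
        (W.base.contDiffOn_hessian W.contDiffOn u w))
  have hd := (hF.hasFDerivAt.comp x hasFDerivAt_fst).smul_const (-v)
  simp only [Function.comp_def] at hd
  rw [W.nablaThree_snd hx, he.fderiv_eq, hd.fderiv]
  simp only [nablaTwo, W.christoffel_eq hx, W.curvature_snd hx]
  simp [W.fiber.curvature_zero_left hx.2, tensorG, ← christoffelCLM_apply]
  module

/-- The vertical part of R(u, v)w vanishes identically for u, v vertical and w horizontal, so only
the Christoffel corrections of the arguments contribute. Those of u and v have horizontal part along
grad φ and give the Hessian; that of w is (dφ(w)/φ) z and gives the fiber curvature. -/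
theorem nablaThree_fiber_base (W : IsWarpedOn h h₁ h₂ φ U₁ U₂) (hx : x ∈ U₁ ×ˢ U₂) (z u v : E₂)
    (w : E₁) :
    (nablaThree h (curvature h) x (0, z) (0, u) (0, v) (w, 0)).2 =
      -(hessian h₁ φ x.1 (grad h₁ φ x.1) w) • tensorG h₂ x.2 u v z -
        (fderiv ℝ φ x.1 w / φ x.1) • (curvature h₂ x.2 u v z -
          fderiv ℝ φ x.1 (grad h₁ φ x.1) • tensorG h₂ x.2 u v z) := by
  have hφ := (W.pos _ hx.1).ne'
  have hz (p : E₁) : hessian h₁ φ x.1 0 p = 0 := W.base.hessian_zero_left hx.1 W.contDiffOn p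
  have he : (fun y => (curvature h y ((0 : E₁), u) (0, v) (w, 0)).2) =ᶠ[nhds x] fun y => 0 := by
    filter_upwards [W.isOpen.mem_nhds hx] with y hy
    simp [W.curvature_snd hy, W.fiber.curvature_zero_right hy.2, tensorG,
      W.base.hessian_zero_left hy.1 W.contDiffOn]
  rw [W.nablaThree_snd hx, he.fderiv_eq]
  simp only [W.christoffel_eq hx, W.curvature_snd hx, W.curvature_fst hx]
  simp [W.fiber.curvature_zero_right hx.2, W.base.curvature_zero_left hx.1, tensorG,
    ← christoffelCLM_apply, hz, W.fiber.symm _ hx.2 z, W.fiber.curvature_smul_right hx.2]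
  simp only [← neg_smul (φ x.1 * _), W.base.hessian_smul_left hx.1 W.contDiffOn]
  match_scalars <;> field_simp

/-- In a locally symmetric warped product the fiber has constant curvature, and the constant is
determined by the base at any point that is not critical for the warping function. -/
theorem curvature_fiber_eq (W : IsWarpedOn h h₁ h₂ φ U₁ U₂) {y₁ : E₁} (hy₁ : y₁ ∈ U₁) {y₂ : E₂}
    (hy₂ : y₂ ∈ U₂) {u v z : E₂} {w : E₁} (hw : fderiv ℝ φ y₁ w ≠ 0)
    (hR : nablaThree h (curvature h) (y₁, y₂) (0, z) (0, u) (0, v) (w, 0) = 0) :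
    curvature h₂ y₂ u v z = (fderiv ℝ φ y₁ (grad h₁ φ y₁) -
      φ y₁ / fderiv ℝ φ y₁ w * hessian h₁ φ y₁ (grad h₁ φ y₁) w) • tensorG h₂ y₂ u v z := by
  have hφ := (W.pos _ hy₁).ne'
  have key := W.nablaThree_fiber_base (x := (y₁, y₂)) ⟨hy₁, hy₂⟩ z u v w
  rw [hR, Prod.snd_zero] at key
  have key' := congrArg (fun t => (φ y₁ / fderiv ℝ φ y₁ w) • t) key
  simp only [smul_zero] at key'
  rw [← sub_eq_zero, ← neg_eq_zero, key']
  match_scalars <;> field_simp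
  ring

end IsWarpedOn

end WarpedSymmetric

/-! ### Metrics and functions read in charts of a manifold. -/

section Charts

variable {E : Type*} [NormedAddCommGroup E] [NormedSpace ℝ E]
  {H : Type*} [TopologicalSpace H] {I : ModelWithCorners ℝ E H}
  {M : Type*} [TopologicalSpace M] [ChartedSpace H M] [IsManifold I ∞ M]
  {e : OpenPartialHomeomorph M H}

theorem contMDiffOn_extend_symm_target (he : e ∈ atlas H M) :
    ContMDiffOn 𝓘(ℝ, E) I ∞ (e.extend I).symm (e.extend I).target := by
  rw [e.extend_target']
  exact _root_.contMDiffOn_extend_symm (IsManifold.subset_maximalAtlas he)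

theorem contDiffOn_comp_extend_symm (he : e ∈ atlas H M) {f : M → ℝ}
    (hf : ContMDiff I 𝓘(ℝ, ℝ) ∞ f) :
    ContDiffOn ℝ ∞ (fun y => f ((e.extend I).symm y)) (e.extend I).target :=
  contMDiffOn_iff_contDiffOn.1 (hf.comp_contMDiffOn (contMDiffOn_extend_symm_target he))

variable [I.Boundaryless]

theorem mdifferentiableAt_extend_symm (he : e ∈ atlas H M) {y : E} (hy : y ∈ (e.extend I).target) :
    MDifferentiableAt 𝓘(ℝ, E) I (e.extend I).symm y :=
  ((contMDiffOn_extend_symm_target he y hy).contMDiffAt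
    (e.isOpen_extend_target.mem_nhds hy)).mdifferentiableAt (by simp)

/-- The chart composed with its inverse is the identity near y, so the chain rule provides a left
inverse of the derivative. -/
theorem mfderiv_extend_symm_injective (he : e ∈ atlas H M) {y : E}
    (hy : y ∈ (e.extend I).target) :
    Function.Injective (mfderiv 𝓘(ℝ, E) I (e.extend I).symm y) := by
  have hs : (e.extend I).symm y ∈ e.source := by
    simpa using (e.extend I).map_target hy
  have h1 : MDifferentiableAt I 𝓘(ℝ, E) (e.extend I) ((e.extend I).symm y) :=
    (e.contMDiffAt_extend (n := ∞) (IsManifold.subset_maximalAtlas he) hs).mdifferentiableAt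
      (by simp)
  have h2 := h1.hasMFDerivAt.comp y (mdifferentiableAt_extend_symm he hy).hasMFDerivAt
  have h3 : HasMFDerivAt 𝓘(ℝ, E) 𝓘(ℝ, E) (e.extend I ∘ (e.extend I).symm) y
      (ContinuousLinearMap.id ℝ E) := by
    refine (hasMFDerivAt_id y).congr_of_eventuallyEq ?_
    filter_upwards [e.isOpen_extend_target.mem_nhds hy] with z hz
    exact (e.extend I).right_inv hz
  have h4 := hasMFDerivAt_unique h2 h3
  intro v w hvw
  have hv := DFunLike.congr_fun h4 v
  have hw := DFunLike.congr_fun h4 w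
  simp only [ContinuousLinearMap.comp_apply, hvw] at hv hw
  exact hv.symm.trans hw

theorem mfderiv_extend_symm_surjective [FiniteDimensional ℝ E] (he : e ∈ atlas H M) {y : E}
    (hy : y ∈ (e.extend I).target) :
    Function.Surjective (mfderiv 𝓘(ℝ, E) I (e.extend I).symm y) := by
  let A : E →L[ℝ] E := mfderiv 𝓘(ℝ, E) I (e.extend I).symm y
  exact LinearMap.injective_iff_surjective (f := (A : E →ₗ[ℝ] E)).1
    (mfderiv_extend_symm_injective he hy)

/-- This is the tangent map of the inverse chart applied to a constant vector field; it supplies the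
smooth vectors on which the metric is evaluated in the chart. -/
theorem contMDiffOn_mfderiv_extend_symm (he : e ∈ atlas H M) (v : E) :
    ContMDiffOn 𝓘(ℝ, E) I.tangent ∞
      (fun y => (⟨(e.extend I).symm y, mfderiv 𝓘(ℝ, E) I (e.extend I).symm y v⟩ :
        TangentBundle I M)) (e.extend I).target := by
  have ho : IsOpen (e.extend I).target := e.isOpen_extend_target
  have h1 := (contMDiffOn_extend_symm_target (I := I) he).contMDiffOn_tangentMapWithin
    (m := ∞) (by simp) ho.uniqueMDiffOn
  have h2 : ContMDiff 𝓘(ℝ, E) 𝓘(ℝ, E).tangent ∞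
      (fun y => (⟨y, v⟩ : TangentBundle 𝓘(ℝ, E) E)) :=
    contMDiff_vectorSpace_iff_contDiff.2 contDiff_const
  refine (h1.comp h2.contMDiffOn (fun y hy => hy)).congr fun y hy => ?_
  simp only [Function.comp_apply, tangentMapWithin]
  rw [mfderivWithin_of_isOpen ho hy]

theorem contDiffOn_metricInChart_apply
    {g : ∀ p : M, TangentSpace I p →L[ℝ] TangentSpace I p →L[ℝ] ℝ}
    (hg : IsPseudoRiemannianMetric I g) (he : e ∈ atlas H M) (v w : E) :
    ContDiffOn ℝ ∞ (fun y => metricInChart I g e y v w) (e.extend I).target := by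
  intro y hy
  have h1 := hg.contMDiff.comp_contMDiffOn (contMDiffOn_extend_symm_target he) y hy
  have h2 := ContMDiffWithinAt.clm_bundle_apply₂
    (F₃ := ℝ) (E₃ := Bundle.Trivial M ℝ) (b := (e.extend I).symm)
    (ψ := fun y => g ((e.extend I).symm y)) h1
    (contMDiffOn_mfderiv_extend_symm he v y hy) (contMDiffOn_mfderiv_extend_symm he w y hy)
  rw [Bundle.contMDiffWithinAt_totalSpace] at h2
  exact contMDiffWithinAt_iff_contDiffWithinAt.1 h2.2

theorem isMetricOn_metricInChart [FiniteDimensional ℝ E]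
    {g : ∀ p : M, TangentSpace I p →L[ℝ] TangentSpace I p →L[ℝ] ℝ}
    (hg : IsPseudoRiemannianMetric I g) (he : e ∈ atlas H M) :
    IsMetricOn (metricInChart I g e) (e.extend I).target where
  isOpen := e.isOpen_extend_target
  contDiffOn := by
    refine contDiffOn_clm_apply.2 fun v => contDiffOn_clm_apply.2 fun w => ?_
    exact contDiffOn_metricInChart_apply hg he v w
  symm y _ v w := hg.symm ((e.extend I).symm y) (mfderiv 𝓘(ℝ, E) I (e.extend I).symm y v)
    (mfderiv 𝓘(ℝ, E) I (e.extend I).symm y w)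
  nondegenerate y hy v hv := by
    have hinj := mfderiv_extend_symm_injective (I := I) he hy
    refine hinj ((hg.nondegenerate ((e.extend I).symm y)
      (mfderiv 𝓘(ℝ, E) I (e.extend I).symm y v) fun w => ?_).trans (map_zero _).symm)
    obtain ⟨w, rfl⟩ := mfderiv_extend_symm_surjective (I := I) he hy w
    exact hv w

/-- Otherwise f would be locally constant, hence constant by connectedness. -/
theorem exists_fderiv_ne_zero [PreconnectedSpace M] {f : M → ℝ} (hf : ContMDiff I 𝓘(ℝ, ℝ) ∞ f)
    (hne : ∃ p q, f p ≠ f q) :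
    ∃ e ∈ atlas H M, ∃ y ∈ (e.extend I).target,
      fderiv ℝ (fun y => f ((e.extend I).symm y)) y ≠ 0 := by
  by_contra! hzero
  obtain ⟨p, q, hpq⟩ := hne
  refine hpq (IsLocallyConstant.apply_eq_of_preconnectedSpace
    ((IsLocallyConstant.iff_eventually_eq f).2 fun x => ?_) p q)
  have he := chart_mem_atlas H x
  set e := chartAt H x
  have hx : x ∈ (e.extend I).source := by simp [e]
  have hy := (e.extend I).map_source hx
  have ho : IsOpen (e.extend I).target := e.isOpen_extend_target
  -- The chart target need not be connected, so the argument is made on a ball around the image of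
  -- x.
  obtain ⟨r, hr, hball⟩ := Metric.isOpen_iff.1 ho _ hy
  have hconst {z : E} := Metric.isOpen_ball.is_const_of_fderiv_eq_zero
    (convex_ball (e.extend I x) r).isPreconnected
    (((contDiffOn_comp_extend_symm he hf).differentiableOn (by simp)).mono hball)
    (fun y hy => hzero e he y (hball hy)) (x := e.extend I x) (y := z)
    (Metric.mem_ball_self hr)
  have hcont : ContinuousAt (e.extend I) x := e.continuousAt_extend (by simpa using hx)
  filter_upwards [hcont (Metric.ball_mem_nhds _ hr), e.isOpen_extend_source.mem_nhds hx] with z hz hzs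
  simpa only [(e.extend I).left_inv hzs, (e.extend I).left_inv hx] using (hconst hz).symm

end Charts

/-! ### The warped product metric in product charts. -/

section WarpedChart

variable {E₁ : Type*} [NormedAddCommGroup E₁] [NormedSpace ℝ E₁]
  {H₁ : Type*} [TopologicalSpace H₁] {I₁ : ModelWithCorners ℝ E₁ H₁}
  {M₁ : Type*} [TopologicalSpace M₁]
  {E₂ : Type*} [NormedAddCommGroup E₂] [NormedSpace ℝ E₂]
  {H₂ : Type*} [TopologicalSpace H₂] {I₂ : ModelWithCorners ℝ E₂ H₂}
  {M₂ : Type*} [TopologicalSpace M₂]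

theorem extend_prod_target (e₁ : OpenPartialHomeomorph M₁ H₁) (e₂ : OpenPartialHomeomorph M₂ H₂) :
    ((e₁.prod e₂).extend (I₁.prod I₂)).target =
      (e₁.extend I₁).target ×ˢ (e₂.extend I₂).target := by
  rw [e₁.extend_prod e₂]; rfl

variable [I₁.Boundaryless] [ChartedSpace H₁ M₁] [IsManifold I₁ ∞ M₁]
  [I₂.Boundaryless] [ChartedSpace H₂ M₂] [IsManifold I₂ ∞ M₂]
  {g₁ : ∀ p : M₁, TangentSpace I₁ p →L[ℝ] TangentSpace I₁ p →L[ℝ] ℝ}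
  {g₂ : ∀ q : M₂, TangentSpace I₂ q →L[ℝ] TangentSpace I₂ q →L[ℝ] ℝ}
  {f : M₁ → ℝ} {e₁ : OpenPartialHomeomorph M₁ H₁} {e₂ : OpenPartialHomeomorph M₂ H₂}

theorem mfderiv_extend_prod_symm (he₁ : e₁ ∈ atlas H₁ M₁) (he₂ : e₂ ∈ atlas H₂ M₂)
    {y : E₁ × E₂} (hy : y ∈ (e₁.extend I₁).target ×ˢ (e₂.extend I₂).target) :
    mfderiv 𝓘(ℝ, E₁ × E₂) (I₁.prod I₂) ((e₁.prod e₂).extend (I₁.prod I₂)).symm y =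
      ((mfderiv 𝓘(ℝ, E₁) I₁ (e₁.extend I₁).symm y.1 : E₁ →L[ℝ] E₁).comp
          (ContinuousLinearMap.fst ℝ E₁ E₂)).prod
        ((mfderiv 𝓘(ℝ, E₂) I₂ (e₂.extend I₂).symm y.2 : E₂ →L[ℝ] E₂).comp
          (ContinuousLinearMap.snd ℝ E₁ E₂)) := by
  have h1 := (mdifferentiableAt_extend_symm he₁ hy.1).hasMFDerivAt.comp y
    (hasFDerivAt_fst (𝕜 := ℝ) (E := E₁) (F := E₂)).hasMFDerivAt
  have h2 := (mdifferentiableAt_extend_symm he₂ hy.2).hasMFDerivAt.comp y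
    (hasFDerivAt_snd (𝕜 := ℝ) (E := E₁) (F := E₂)).hasMFDerivAt
  exact (h1.prodMk h2).mfderiv

variable [FiniteDimensional ℝ E₁] [FiniteDimensional ℝ E₂]

theorem isWarpedOn_metricInChart (hg₁ : IsPseudoRiemannianMetric I₁ g₁)
    (hg₂ : IsPseudoRiemannianMetric I₂ g₂) (hf : ContMDiff I₁ 𝓘(ℝ, ℝ) ∞ f) (hfpos : ∀ p, 0 < f p)
    (he₁ : e₁ ∈ atlas H₁ M₁) (he₂ : e₂ ∈ atlas H₂ M₂) :
    IsWarpedOn (metricInChart (I₁.prod I₂) (warpedMetric I₁ I₂ g₁ g₂ f) (e₁.prod e₂))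
      (metricInChart I₁ g₁ e₁) (metricInChart I₂ g₂ e₂) (fun y => f ((e₁.extend I₁).symm y))
      (e₁.extend I₁).target (e₂.extend I₂).target where
  base := isMetricOn_metricInChart hg₁ he₁
  fiber := isMetricOn_metricInChart hg₂ he₂
  contDiffOn := contDiffOn_comp_extend_symm he₁ hf
  pos y _ := hfpos _
  apply y hy v w := by
    simp only [metricInChart, pullbackForm, mfderiv_extend_prod_symm he₁ he₂ hy, warpedMetric,
      mfderiv_fst, mfderiv_snd]
    rfl

theorem nablaThree_curvature_warped (hg₁ : IsPseudoRiemannianMetric I₁ g₁)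
    (hg₂ : IsPseudoRiemannianMetric I₂ g₂) (hf : ContMDiff I₁ 𝓘(ℝ, ℝ) ∞ f) (hfpos : ∀ p, 0 < f p)
    (hn : 3 ≤ Module.finrank ℝ E₁ + Module.finrank ℝ E₂)
    (hC : IsConcircularlySymmetric (I₁.prod I₂) (warpedMetric I₁ I₂ g₁ g₂ f))
    (he₁ : e₁ ∈ atlas H₁ M₁) (he₂ : e₂ ∈ atlas H₂ M₂) {y : E₁ × E₂}
    (hy : y ∈ (e₁.extend I₁).target ×ˢ (e₂.extend I₂).target) (z u v w : E₁ × E₂) :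
    nablaThree (metricInChart (I₁.prod I₂) (warpedMetric I₁ I₂ g₁ g₂ f) (e₁.prod e₂))
      (curvature (metricInChart (I₁.prod I₂) (warpedMetric I₁ I₂ g₁ g₂ f) (e₁.prod e₂)))
      y z u v w = 0 :=
  (isWarpedOn_metricInChart hg₁ hg₂ hf hfpos he₁ he₂).isMetricOn.nablaThree_curvature_eq_zero hy
    (by rwa [Module.finrank_prod])
    (hC _ (Set.mem_image2_of_mem he₁ he₂) y (by rwa [extend_prod_target])) z u v w

end WarpedChart

end PseudoRiem

/-! ### The theorem, assembled from the components of ∇R = 0. -/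

theorem mainTheorem3
    {E₁ : Type*} [NormedAddCommGroup E₁] [NormedSpace ℝ E₁] [FiniteDimensional ℝ E₁]
    {H₁ : Type*} [TopologicalSpace H₁] (I₁ : ModelWithCorners ℝ E₁ H₁) [I₁.Boundaryless]
    {M₁ : Type*} [TopologicalSpace M₁] [ChartedSpace H₁ M₁] [IsManifold I₁ ∞ M₁] [Nonempty M₁]
    {E₂ : Type*} [NormedAddCommGroup E₂] [NormedSpace ℝ E₂] [FiniteDimensional ℝ E₂]
    {H₂ : Type*} [TopologicalSpace H₂] (I₂ : ModelWithCorners ℝ E₂ H₂) [I₂.Boundaryless]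
    {M₂ : Type*} [TopologicalSpace M₂] [ChartedSpace H₂ M₂] [IsManifold I₂ ∞ M₂] [Nonempty M₂]
    (g₁ : ∀ p : M₁, TangentSpace I₁ p →L[ℝ] TangentSpace I₁ p →L[ℝ] ℝ)
    (hg₁ : PseudoRiem.IsPseudoRiemannianMetric I₁ g₁)
    (g₂ : ∀ q : M₂, TangentSpace I₂ q →L[ℝ] TangentSpace I₂ q →L[ℝ] ℝ)
    (hg₂ : PseudoRiem.IsPseudoRiemannianMetric I₂ g₂)
    (f : M₁ → ℝ) (hf : ContMDiff I₁ 𝓘(ℝ, ℝ) ∞ f) (hfpos : ∀ p, 0 < f p)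
    (hn₂ : 1 ≤ Module.finrank ℝ E₂)
    (hn : 3 ≤ Module.finrank ℝ E₁ + Module.finrank ℝ E₂)
    (hC : PseudoRiem.IsConcircularlySymmetric (I₁.prod I₂)
      (PseudoRiem.warpedMetric I₁ I₂ g₁ g₂ f)) :
    (PseudoRiem.IsLocallySymmetric I₁ g₁ ∧ PseudoRiem.IsLocallySymmetric I₂ g₂) ∧
    (PreconnectedSpace M₁ → (∃ p q : M₁, f p ≠ f q) →
      PseudoRiem.HasConstantCurvature I₂ g₂) ∧
    PseudoRiem.IsParallelTensorF I₁ g₁ f := by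
  have hW := fun e₁ (he₁ : e₁ ∈ atlas H₁ M₁) e₂ (he₂ : e₂ ∈ atlas H₂ M₂) =>
    PseudoRiem.isWarpedOn_metricInChart hg₁ hg₂ hf hfpos he₁ he₂
  have hR := fun e₁ (he₁ : e₁ ∈ atlas H₁ M₁) e₂ (he₂ : e₂ ∈ atlas H₂ M₂) y hy =>
    PseudoRiem.nablaThree_curvature_warped hg₁ hg₂ hf hfpos hn hC he₁ he₂ (y := y) hy
  -- A statement about one factor needs only a single point of the other, which nonemptiness
  -- supplies.
  have hchart₁ : ∃ e₁ ∈ atlas H₁ M₁, ∃ y, y ∈ (e₁.extend I₁).target :=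
    ⟨_, chart_mem_atlas H₁ (Classical.arbitrary M₁), _, mem_extChartAt_target (Classical.arbitrary M₁)⟩
  have hchart₂ : ∃ e₂ ∈ atlas H₂ M₂, ∃ y, y ∈ (e₂.extend I₂).target :=
    ⟨_, chart_mem_atlas H₂ (Classical.arbitrary M₂), _, mem_extChartAt_target (Classical.arbitrary M₂)⟩
  refine ⟨⟨fun e₁ he₁ y₁ hy₁ z u v w => ?_, fun e₂ he₂ y₂ hy₂ z u v w => ?_⟩,
    fun hconn hne => ?_, fun e₁ he₁ y₁ hy₁ z u w => ?_⟩
  · obtain ⟨e₂, he₂, y₂, hy₂⟩ := hchart₂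
    have hy : (y₁, y₂) ∈ (e₁.extend I₁).target ×ˢ (e₂.extend I₂).target := ⟨hy₁, hy₂⟩
    rw [← (hW e₁ he₁ e₂ he₂).nablaThree_base hy, hR e₁ he₁ e₂ he₂ _ hy, Prod.fst_zero]
  · obtain ⟨e₁, he₁, y₁, hy₁⟩ := hchart₁
    have hy : (y₁, y₂) ∈ (e₁.extend I₁).target ×ˢ (e₂.extend I₂).target := ⟨hy₁, hy₂⟩
    rw [← (hW e₁ he₁ e₂ he₂).nablaThree_fiber hy, hR e₁ he₁ e₂ he₂ _ hy, Prod.snd_zero]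
  · obtain ⟨e₁, he₁, y₁, hy₁, hne₁⟩ := PseudoRiem.exists_fderiv_ne_zero hf hne
    obtain ⟨w, hw⟩ : ∃ w, fderiv ℝ (fun y => f ((e₁.extend I₁).symm y)) y₁ w ≠ 0 := by
      by_contra! hzero
      exact hne₁ (ContinuousLinearMap.ext hzero)
    -- The constant is the coefficient in `curvature_fiber_eq` at the chosen y₁ and w; it involves
    -- neither the fiber point nor the fiber chart.
    exact ⟨_, fun e₂ he₂ y₂ hy₂ u v z => (hW e₁ he₁ e₂ he₂).curvature_fiber_eq hy₁ hy₂
      hw (hR e₁ he₁ e₂ he₂ _ ⟨hy₁, hy₂⟩ _ _ _ _)⟩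
  · obtain ⟨e₂, he₂, y₂, hy₂⟩ := hchart₂
    have hy : (y₁, y₂) ∈ (e₁.extend I₁).target ×ˢ (e₂.extend I₂).target := ⟨hy₁, hy₂⟩
    -- A nonzero vertical v is needed to pass from (∇F) v = 0 to ∇F = 0.
    have : Nontrivial E₂ := Module.nontrivial_of_finrank_pos (R := ℝ) (by omega)
    obtain ⟨v, hv⟩ := exists_ne (0 : E₂)
    have key := (hW e₁ he₁ e₂ he₂).nablaThree_mixed hy z u w v
    rw [hR e₁ he₁ e₂ he₂ _ hy, Prod.snd_zero, eq_comm, smul_eq_zero, neg_eq_zero] at key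
    exact key.resolve_right hv
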